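/- Consider a market with $n$ schools, each having exactly one seat, and infinitely many students in positions $i=1,2,3,\dots$. Each student has a strict preference list of $d\le n$ distinct schools; the lists are independent, and each is uniformly random among all ordered lists of $d$ distinct schools. In the order of their positions, each student takes the most preferred school on their list that is still available, and stays unmatched if all schools on their list are already taken (Serial Dictatorship). Let $K_i^{n,d}\in\{1,\dots,d,\infty\}$ be the position, within student $i$'s list, of the school to which student $i$ is matched (with $K_i^{n,d}=\infty$ if student $i$ is unmatched), and let $M_i^{n,d}=\mathbb{1}_{\{K_i^{n,d}<\infty\}}$. Theorem. Let $d,\ell\in\mathbb{N}$ with $\ell\ge d$. Then there is $N=N(d,\ell)$ such that for every $n\ge N$ and every $i\in\{1,\dots,n\}$, $$\mathbb{P}(M_i^{n,\ell}=1)\ \ge\ \mathbb{P}(M_i^{n,d}=1).$$ -/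

import Mathlib

open MeasureTheory ProbabilityTheory

/-- A strict preference list of `d` distinct schools out of the `n` schools `Fin n`;
`l 0` is the most preferred school, `l 1` the second most preferred one, and so on.
Schools not in the range of `l` are unacceptable. -/
abbrev PrefList (n d : ℕ) : Type := Fin d ↪ Fin n

/-- The discrete σ-algebra on the finite set of preference lists. -/
instance PrefList.instMeasurableSpace (n d : ℕ) : MeasurableSpace (PrefList n d) := ⊤

namespace SerialDictatorship

variable {n d : ℕ}

/-- The (0-based) position, within the list `l`, of the most preferred school that is not in the
set `S` of schools already taken; `none` if all schools of the list are taken. -/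
def choice (S : Finset (Fin n)) (l : PrefList n d) : Option (Fin d) :=
  Fin.find? fun k => decide (l k ∉ S)

/-- The set of schools that are taken after the first `i` students have had their turn, when the
student with index `j` (that is, in position `j + 1`) has the list `L j`. Each school has a single
seat, and each student in turn takes their most preferred school among those that are left. -/
def taken (L : ℕ → PrefList n d) : ℕ → Finset (Fin n)
  | 0 => ∅
  | i + 1 =>
    match choice (taken L i) (L i) with
    | none => taken L i
    | some k => insert (L i k) (taken L i)

/-- The rank `K ∈ {1, …, d, ∞}`, within their own list, of the school to which the student with
index `i` is matched (`∞` if that student stays unmatched). -/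
def rank (L : ℕ → PrefList n d) (i : ℕ) : ℕ∞ :=
  match choice (taken L i) (L i) with
  | none => ⊤
  | some k => ((k : ℕ) + 1 : ℕ)

/-- The indicator `M = 1_{K < ∞}` of the student with index `i` being matched to some school. -/
noncomputable def matched (L : ℕ → PrefList n d) (i : ℕ) : ℕ :=
  open Classical in if rank L i < ⊤ then 1 else 0

/-- The random lists `L 0, L 1, …` of the infinitely many students are independent, and each of
them is uniformly distributed on the lists of `d` distinct schools out of `n`. -/
structure IsRandomMarket {Ω : Type*} [MeasurableSpace Ω] (P : Measure Ω)
    (L : ℕ → Ω → PrefList n d) : Prop where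
  measurable : ∀ i, Measurable (L i)
  uniform : ∀ i, P.map (L i) = uniformOn Set.univ
  indep : iIndepFun L P

end SerialDictatorship

/-! The number `S` of taken schools is a Markov chain: it stays at `s` with probability `blocked n d
s = C(s,d)/C(n,d)` and otherwise moves to `s + 1`. A student is unmatched with probability
`E[blocked n d S]` (`IsRandomMarket.measure_matched`), so two such expectations have to be compared,
in two time ranges.

As `n → ∞`, `S/n` follows the fluid limit `x' = 1 - x ^ d`, with error uniform in `i ≤ n`
(`exists_abs_expect_blocked_sub_le`), and `fluid_pow_lt` compares the limiting unmatched fractions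
strictly on `(0, 1]`. By compactness the gap is uniform away from time `0` (`exists_fluid_gap`) and
absorbs the error.

Near time `0` the gap vanishes, so `expect_blocked_le_of_early` handles `i/n ≤ 1/(d+1)` without a
limit: few early students are blocked, so `S` is close to `i`, while one more list entry already
multiplies the blocking probability by at most `i/n`. -/

namespace SerialDictatorship

/-! ### Blocking probabilities -/

/-- The probability that a uniformly random list of `d` out of `n` schools only contains schools
from a given set of `s` schools. -/
noncomputable def blocked (n d s : ℕ) : ℝ := (s.choose d : ℝ) / (n.choose d : ℝ)

/-- The transition operator of the number of taken schools. -/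
noncomputable def step (n d : ℕ) (G : ℕ → ℝ) (s : ℕ) : ℝ :=
  blocked n d s * G s + (1 - blocked n d s) * G (s + 1)

/-- The expectation of `G` evaluated at the number of schools taken by the first `i` students. -/
noncomputable def expect (n d : ℕ) : ℕ → (ℕ → ℝ) → ℝ
  | 0, G => G 0
  | i + 1, G => expect n d i (step n d G)

lemma blocked_nonneg (n d s : ℕ) : 0 ≤ blocked n d s := by unfold blocked; positivity

lemma blocked_mono (n d : ℕ) : Monotone (blocked n d) := by
  intro s t h
  unfold blocked
  gcongr

lemma blocked_le_one {n d s : ℕ} (h : s ≤ n) : blocked n d s ≤ 1 :=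
  div_le_one_of_le₀ (by exact_mod_cast Nat.choose_le_choose d h) (by positivity)

lemma blocked_zero (n s : ℕ) : blocked n 0 s = 1 := by simp [blocked]

lemma blocked_succ {n k s : ℕ} (hk : k < n) :
    blocked n (k + 1) s * (n - k) = blocked n k s * ((s - k : ℕ) : ℝ) := by
  have h1 : ((n.choose (k + 1) : ℕ) : ℝ) * (k + 1) = n.choose k * (n - k) := by
    have := Nat.choose_succ_right_eq n k
    rw [← Nat.cast_sub hk.le]
    exact_mod_cast this
  have h2 : ((s.choose (k + 1) : ℕ) : ℝ) * (k + 1) = s.choose k * ((s - k : ℕ) : ℝ) := by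
    exact_mod_cast Nat.choose_succ_right_eq s k
  have p1 : (0 : ℝ) < n.choose (k + 1) := by exact_mod_cast Nat.choose_pos hk
  have p2 : (0 : ℝ) < n.choose k := by exact_mod_cast Nat.choose_pos hk.le
  have p3 : (0 : ℝ) < (k : ℝ) + 1 := by positivity
  unfold blocked
  rw [div_mul_eq_mul_div, div_mul_eq_mul_div, div_eq_div_iff p1.ne' p2.ne']
  apply mul_right_cancel₀ p3.ne'
  linear_combination (n - k : ℝ) * n.choose k * h2 - s.choose k * ((s - k : ℕ) : ℝ) * h1

/-- The ratio of consecutive blocking probabilities is `(s - k)/(n - k) ≤ s/n`, or `0` once `k ≥ s`.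
-/
lemma blocked_succ_le {n k s : ℕ} (hk : k < n) (hs : s ≤ n) :
    blocked n (k + 1) s ≤ s / n * blocked n k s := by
  have hn : (0 : ℝ) < n := by exact_mod_cast (Nat.zero_le k).trans_lt hk
  have hkn : (0 : ℝ) < (n : ℝ) - k := by
    have : (k : ℝ) < n := by exact_mod_cast hk
    linarith
  rw [← mul_le_mul_iff_left₀ hkn, blocked_succ hk, div_mul_eq_mul_div, div_mul_eq_mul_div,
    le_div_iff₀ hn]
  have hb := blocked_nonneg n k s
  have hsn : (s : ℝ) ≤ n := by exact_mod_cast hs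
  rcases le_total k s with h | h
  · rw [Nat.cast_sub h]
    have : ((s : ℝ) - k) * n ≤ s * (n - k) := by nlinarith [(Nat.cast_nonneg k : (0 : ℝ) ≤ k)]
    nlinarith [mul_le_mul_of_nonneg_left this hb]
  · rw [Nat.sub_eq_zero_of_le h]
    simp only [Nat.cast_zero, mul_zero, zero_mul]
    positivity

lemma blocked_le_div_pow {n d s : ℕ} (hd : d ≤ n) (hs : s ≤ n) :
    blocked n d s ≤ (s / n : ℝ) ^ d := by
  induction d with
  | zero => simp [blocked_zero]
  | succ k ih =>
    refine (blocked_succ_le hd hs).trans ?_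
    rw [pow_succ']
    gcongr
    exact ih (by omega)

/-- Each of the `k` factors is at least `s/n - d/n`, so the errors add up to `k * d / n`. Keeping
`d` fixed while `k` grows makes the induction go through. -/
lemma div_pow_le_blocked {n d k s : ℕ} (hd : d ≤ n) (hs : s ≤ n) (hk : k ≤ d) :
    (s / n : ℝ) ^ k - k * d / n ≤ blocked n k s := by
  induction k with
  | zero => simp [blocked_zero]
  | succ k ih =>
    have ih := ih (by omega)
    have hn : (0 : ℝ) < n := by
      have : 0 < n := by omega
      exact_mod_cast this
    have hkn : (0 : ℝ) < (n : ℝ) - k := by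
      have : (k : ℝ) < n := by exact_mod_cast (by omega : k < n)
      linarith
    have hb := blocked_nonneg n k s
    have hb1 : blocked n k s ≤ 1 := blocked_le_one hs
    have hsn : (s : ℝ) ≤ n := by exact_mod_cast hs
    have hs1 : (s : ℝ) / n ≤ 1 := div_le_one_of_le₀ hsn hn.le
    have hs0 : 0 ≤ (s : ℝ) / n := by positivity
    have hkd : (k : ℝ) ≤ d := by exact_mod_cast (by omega : k ≤ d)
    have hdn : 0 ≤ (d : ℝ) / n := by positivity
    have h1 : blocked n k s * (s / n - d / n) ≤ blocked n (k + 1) s := by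
      have e : blocked n (k + 1) s = blocked n k s * (((s - k : ℕ) : ℝ) / (n - k)) := by
        rw [mul_div_assoc', ← blocked_succ (by omega), mul_div_cancel_right₀ _ hkn.ne']
      rw [e]
      apply mul_le_mul_of_nonneg_left _ hb
      have h2 : (s : ℝ) - d ≤ ((s - k : ℕ) : ℝ) := by
        have : (s : ℝ) ≤ ((s - k : ℕ) : ℝ) + k := by exact_mod_cast (by omega : s ≤ s - k + k)
        linarith
      calc (s / n - d / n : ℝ) = (s - d) / n := by ring
        _ ≤ ((s - k : ℕ) : ℝ) / n := by gcongr
        _ ≤ _ := by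
          gcongr
          linarith [(Nat.cast_nonneg k : (0 : ℝ) ≤ k)]
    have h3 : ((s : ℝ) / n) ^ (k + 1) - k * d / n ≤ s / n * blocked n k s := by
      have h4 : 0 ≤ (k : ℝ) * d / n := by positivity
      have := mul_le_mul_of_nonneg_left ih hs0
      rw [pow_succ']
      nlinarith
    have h5 : blocked n k s * (d / n) ≤ d / n := mul_le_of_le_one_left hdn hb1
    have h6 : ((k + 1 : ℕ) : ℝ) * d / n = k * d / n + d / n := by push_cast; ring
    rw [h6]
    nlinarith

lemma abs_blocked_sub_le {n d s : ℕ} (hd : d ≤ n) (hs : s ≤ n) :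
    |blocked n d s - (s / n : ℝ) ^ d| ≤ d ^ 2 / n := by
  have h1 := blocked_le_div_pow hd hs
  have h2 := div_pow_le_blocked hd hs le_rfl
  have h3 : 0 ≤ (d : ℝ) ^ 2 / n := by positivity
  rw [abs_le]
  constructor
  · rw [sq]; linarith
  · linarith

lemma blocked_le_mul_blocked {n d l s : ℕ} (hdl : d < l) (hl : l ≤ n) (hs : s ≤ n) :
    blocked n l s ≤ s / n * blocked n d s := by
  have hs1 : (s : ℝ) / n ≤ 1 := div_le_one_of_le₀ (by exact_mod_cast hs) (by positivity)
  induction l, hdl using Nat.le_induction with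
  | base => exact blocked_succ_le (by omega) hs
  | succ m hm ih =>
    refine (blocked_succ_le (by omega) hs).trans ((mul_le_of_le_one_left
      (blocked_nonneg _ _ _) hs1).trans (ih (by omega)))

/-! ### Expectations along the chain -/

lemma expect_add (n d i : ℕ) (F G : ℕ → ℝ) :
    expect n d i (fun s => F s + G s) = expect n d i F + expect n d i G := by
  induction i generalizing F G with
  | zero => rfl
  | succ i ih =>
    simp only [expect]
    rw [← ih]
    congr 1
    funext s
    simp only [step]
    ring

lemma expect_const_mul (n d i : ℕ) (c : ℝ) (G : ℕ → ℝ) :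
    expect n d i (fun s => c * G s) = c * expect n d i G := by
  induction i generalizing G with
  | zero => rfl
  | succ i ih =>
    simp only [expect]
    rw [← ih]
    congr 1
    funext s
    simp only [step]
    ring

lemma expect_const (n d i : ℕ) (c : ℝ) : expect n d i (fun _ => c) = c := by
  induction i with
  | zero => rfl
  | succ i ih =>
    simp only [expect]
    rw [← ih]
    congr 1
    funext s
    simp only [step, ih]
    ring

/-- Both step weights are nonnegative only for `s ≤ n`; since `S ≤ i ≤ n` at time `i`, comparing on
`s ≤ i` suffices. -/
lemma expect_mono {n d i : ℕ} (hi : i ≤ n) {F G : ℕ → ℝ} (h : ∀ s ≤ i, F s ≤ G s) :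
    expect n d i F ≤ expect n d i G := by
  induction i generalizing F G with
  | zero => exact h 0 le_rfl
  | succ i ih =>
    refine ih (by omega) fun s hs => ?_
    have h0 := blocked_nonneg n d s
    have h1 : 0 ≤ 1 - blocked n d s := sub_nonneg.2 (blocked_le_one (by omega))
    exact add_le_add (mul_le_mul_of_nonneg_left (h s (by omega)) h0)
      (mul_le_mul_of_nonneg_left (h (s + 1) (by omega)) h1)

/-! ### Early students -/

/-- While each student is blocked with probability at most `ε`, the chain dominates a binomial
variable with parameters `i` and `1 - ε`, whose `k`-th binomial moment is the left side. Pascal's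
rule on both sides gives the induction. -/
lemma pow_mul_choose_le_expect {n d m : ℕ} {ε : ℝ} (hm : m ≤ n) (hε : ε ≤ 1)
    (hb : blocked n d m ≤ ε) {i : ℕ} (hi : i ≤ m) (k : ℕ) :
    (1 - ε) ^ k * i.choose k ≤ expect n d i (fun s => (s.choose k : ℝ)) := by
  induction i generalizing k with
  | zero =>
    cases k with
    | zero => simp [expect]
    | succ k => simp [expect]
  | succ i ih =>
    cases k with
    | zero => simp [expect_const]
    | succ k =>
      have h0 : 0 ≤ 1 - ε := by linarith
      have key : expect n d i (fun s => (s.choose (k + 1) : ℝ) + (1 - ε) * s.choose k) ≤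
          expect n d (i + 1) (fun s => (s.choose (k + 1) : ℝ)) := by
        refine expect_mono (by omega) fun s hs => ?_
        have h1 : blocked n d s ≤ ε := (blocked_mono n d (by omega)).trans hb
        simp only [step, Nat.choose_succ_succ s k]
        push_cast
        nlinarith [mul_le_mul_of_nonneg_right h1 (Nat.cast_nonneg (α := ℝ) (s.choose k))]
      refine le_trans ?_ key
      rw [expect_add, expect_const_mul, Nat.choose_succ_succ]
      have a := ih (by omega) (k + 1)
      have b := mul_le_mul_of_nonneg_left (ih (by omega) k) h0
      push_cast
      rw [mul_add]
      calc _ = (1 - ε) * ((1 - ε) ^ k * (i.choose k : ℝ))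
            + (1 - ε) ^ (k + 1) * (i.choose (k + 1) : ℝ) := by ring
        _ ≤ _ := by linarith

/-- Early on, longer lists decrease the probability of staying unmatched. -/
lemma expect_blocked_le_of_early {n d l i : ℕ} (hd : 0 < d) (hdl : d < l) (hl : l ≤ n)
    (hin : i ≤ n) (hi : (i / n : ℝ) ≤ 1 / (d + 1)) :
    expect n l i (blocked n l) ≤ expect n d i (blocked n d) := by
  have h1 : expect n l i (blocked n l) ≤ blocked n l i := by
    refine (expect_mono hin fun s hs => blocked_mono n l hs).trans (expect_const ..).le
  have hx0 : 0 ≤ (i / n : ℝ) := by positivity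
  have hε1 : (1 : ℝ) / (d + 1) ≤ 1 := by
    rw [div_le_one (by positivity)]
    linarith [(Nat.cast_nonneg d : (0 : ℝ) ≤ d)]
  have h2 : blocked n d i ≤ 1 / (d + 1) :=
    (blocked_le_div_pow (by omega) hin).trans
      ((pow_le_of_le_one hx0 (hi.trans hε1) hd.ne').trans hi)
  have h3 := pow_mul_choose_le_expect hin hε1 h2 le_rfl d
  -- Bernoulli's inequality. The threshold `1/(d+1)` is the `ε` with `1 - d * ε = ε`, so it bounds
  -- both `i/n` and the loss `(1 - ε) ^ d`.
  have h4 : (1 : ℝ) / (d + 1) ≤ (1 - 1 / (d + 1)) ^ d := by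
    have := one_add_mul_le_pow (a := -(1 / ((d : ℝ) + 1))) (by linarith) d
    have e : 1 + (d : ℝ) * -(1 / (d + 1)) = 1 / (d + 1) := by field_simp; ring
    rw [e] at this
    simpa [sub_eq_add_neg] using this
  have h5 : expect n d i (blocked n d) =
      (n.choose d : ℝ)⁻¹ * expect n d i (fun s => (s.choose d : ℝ)) := by
    rw [← expect_const_mul]
    congr 1
    funext s
    simp only [blocked]
    ring
  have hb := blocked_nonneg n d i
  calc expect n l i (blocked n l) ≤ i / n * blocked n d i :=
        h1.trans (blocked_le_mul_blocked hdl hl hin)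
    _ ≤ (1 - 1 / (d + 1)) ^ d * blocked n d i := by gcongr; exact hi.trans h4
    _ = (n.choose d : ℝ)⁻¹ * ((1 - 1 / (d + 1)) ^ d * i.choose d) := by
        simp only [blocked]; ring
    _ ≤ _ := by rw [h5]; gcongr

/-! ### Hitting times of the fluid limit -/

/-- The middle term is `∫ x ^ m` over `[r, r']`. Summed over the exponents `m = k * d`, this bounds
increments of `hittingTime` by its endpoint slopes `1 / (1 - x ^ d)`. -/
lemma pow_succ_sub_pow_succ_bounds {r r' : ℝ} (h0 : 0 ≤ r) (h : r ≤ r') (m : ℕ) :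
    (r' - r) * r ^ m ≤ (r' ^ (m + 1) - r ^ (m + 1)) / (m + 1) ∧
      (r' ^ (m + 1) - r ^ (m + 1)) / (m + 1) ≤ (r' - r) * r' ^ m := by
  have hm : (0 : ℝ) < m + 1 := by positivity
  rw [le_div_iff₀ hm, div_le_iff₀ hm]
  have hd : 0 ≤ r' - r := by linarith
  induction m with
  | zero => simp
  | succ m ih =>
    obtain ⟨h1, h2⟩ := ih (by positivity)
    have e : r' ^ (m + 1 + 1) - r ^ (m + 1 + 1) =
      r' * (r' ^ (m + 1) - r ^ (m + 1)) + r ^ (m + 1) * (r' - r) := by ring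
    have hp : r ^ (m + 1) ≤ r' ^ (m + 1) := by gcongr
    have hr' : 0 ≤ r' := h0.trans h
    have h3 : r * ((r' - r) * r ^ m * (m + 1)) ≤ r' * (r' ^ (m + 1) - r ^ (m + 1)) :=
      mul_le_mul h h1 (by positivity) hr'
    have h4 := mul_le_mul_of_nonneg_left h2 hr'
    have h5 := mul_le_mul_of_nonneg_right hp hd
    rw [e]
    push_cast
    constructor
    · calc (r' - r) * r ^ (m + 1) * ((m : ℝ) + 1 + 1)
          = r * ((r' - r) * r ^ m * (m + 1)) + r ^ (m + 1) * (r' - r) := by ring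
        _ ≤ _ := by linarith
    · calc _ ≤ r' * ((r' - r) * r' ^ m * (m + 1)) + r' ^ (m + 1) * (r' - r) := by linarith
        _ = _ := by ring

/-- The time `∫₀ᵗ dx / (1 - x ^ d)`, as a power series, at which the fluid limit `x' = 1 - x ^ d`
of the fraction of taken schools reaches the level `t`. -/
noncomputable def hittingTime (d : ℕ) (t : ℝ) : ℝ :=
  ∑' k : ℕ, t ^ (k * d + 1) / ((k * d : ℕ) + 1 : ℝ)

lemma summable_hittingTime {d : ℕ} (hd : 0 < d) {t : ℝ} (h0 : 0 ≤ t) (h1 : t < 1) :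
    Summable fun k : ℕ => t ^ (k * d + 1) / ((k * d : ℕ) + 1 : ℝ) := by
  refine Summable.of_nonneg_of_le (fun k => by positivity) (fun k => ?_)
    (summable_geometric_of_lt_one (pow_nonneg h0 d) (pow_lt_one₀ h0 h1 hd.ne'))
  rw [← pow_mul, mul_comm d k]
  have : t ^ (k * d + 1) ≤ t ^ (k * d) := pow_le_pow_of_le_one h0 h1.le (by omega)
  refine (div_le_self (by positivity) ?_).trans this
  linarith [(Nat.cast_nonneg (k * d) : (0 : ℝ) ≤ ((k * d : ℕ) : ℝ))]

lemma hittingTime_zero (d : ℕ) : hittingTime d 0 = 0 := by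
  simp [hittingTime]

lemma hasSum_mul_pow {d : ℕ} (hd : 0 < d) {t : ℝ} (c : ℝ) (h0 : 0 ≤ t) (h1 : t < 1) :
    HasSum (fun k : ℕ => c * t ^ (k * d)) (c / (1 - t ^ d)) := by
  have := (hasSum_geometric_of_lt_one (pow_nonneg h0 d) (pow_lt_one₀ h0 h1 hd.ne')).mul_left c
  simpa only [← pow_mul, mul_comm d, ← div_eq_mul_inv] using this

lemma hittingTime_sub_bounds {d : ℕ} (hd : 0 < d) {r r' : ℝ} (h0 : 0 ≤ r) (h : r ≤ r')
    (h1 : r' < 1) :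
    (r' - r) / (1 - r ^ d) ≤ hittingTime d r' - hittingTime d r ∧
      hittingTime d r' - hittingTime d r ≤ (r' - r) / (1 - r' ^ d) := by
  have h0' := h0.trans h
  have h1' := h.trans_lt h1
  have hs := (summable_hittingTime hd h0' h1).hasSum.sub (summable_hittingTime hd h0 h1').hasSum
  have key := fun k : ℕ => pow_succ_sub_pow_succ_bounds h0 h (k * d)
  simp only [sub_div] at key
  exact ⟨hasSum_le (fun k => (key k).1) (hasSum_mul_pow hd _ h0 h1') hs,
    hasSum_le (fun k => (key k).2) hs (hasSum_mul_pow hd _ h0' h1)⟩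

lemma hittingTime_lt {d : ℕ} (hd : 0 < d) {r r' : ℝ} (h0 : 0 ≤ r) (h : r < r') (h1 : r' < 1) :
    hittingTime d r < hittingTime d r' := by
  have := (hittingTime_sub_bounds hd h0 h.le h1).1
  have h2 : 0 < (r' - r) / (1 - r ^ d) :=
    div_pos (by linarith) (sub_pos.2 (pow_lt_one₀ h0 (h.trans h1) hd.ne'))
  linarith

lemma exists_hittingTime_eq {d : ℕ} (hd : 0 < d) {s : ℝ} (hs : s ∈ Set.Icc (0 : ℝ) 1) :
    ∃ t, 0 ≤ t ∧ t < 1 ∧ hittingTime d t = s := by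
  -- Two terms of the series already reach time `1` at level `1 - η`: by Bernoulli `(1 - η) ^ (d +
  -- 1) ≥ 1/2`, so the second term is at least `η`.
  set η : ℝ := 1 / (2 * (d + 1)) with hη
  have hη0 : 0 < η := by positivity
  have hdη : ((d : ℝ) + 1) * η = 1 / 2 := by rw [hη]; field_simp
  have hη1 : η ≤ 1 / 2 := by
    nlinarith [mul_nonneg (Nat.cast_nonneg (α := ℝ) d) hη0.le]
  have ht0 : 0 ≤ 1 - η := by linarith
  have ht1 : 1 - η < 1 := by linarith
  have hS : 1 ≤ hittingTime d (1 - η) := by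
    have h := (summable_hittingTime hd ht0 ht1).sum_le_tsum (Finset.range 2)
      (fun k _ => by positivity)
    refine le_trans ?_ h
    rw [Finset.sum_range_succ, Finset.sum_range_one]
    have hb := one_add_mul_le_pow (a := -η) (by linarith) (d + 1)
    have : 1 / 2 / ((d : ℝ) + 1) ≤ (1 - η) ^ (d + 1) / ((d : ℝ) + 1) := by
      gcongr
      push_cast at hb
      rw [← sub_eq_add_neg] at hb
      linarith
    have e : 1 / 2 / ((d : ℝ) + 1) = η := by rw [hη]; field_simp
    simp only [zero_mul, zero_add, pow_one, Nat.cast_zero, div_one, one_mul]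
    linarith
  have hc : ContinuousOn (hittingTime d) (Set.Icc 0 (1 - η)) := by
    have hp : 0 < 1 - (1 - η) ^ d := sub_pos.2 (pow_lt_one₀ ht0 ht1 hd.ne')
    refine LipschitzOnWith.continuousOn (K := Real.toNNReal (1 / (1 - (1 - η) ^ d))) ?_
    have key : ∀ r r', 0 ≤ r → r ≤ r' → r' ≤ 1 - η →
        |hittingTime d r' - hittingTime d r| ≤ 1 / (1 - (1 - η) ^ d) * |r' - r| := by
      intro r r' h0 h h1
      obtain ⟨a, b⟩ := hittingTime_sub_bounds hd h0 h (h1.trans_lt ht1)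
      have c : 0 ≤ (r' - r) / (1 - r ^ d) := div_nonneg (by linarith)
        (sub_nonneg.2 (pow_le_one₀ h0 (by linarith)))
      rw [abs_of_nonneg (c.trans a), abs_of_nonneg (by linarith : 0 ≤ r' - r)]
      refine b.trans ?_
      rw [one_div_mul_eq_div]
      have := h0.trans h
      gcongr
    refine LipschitzOnWith.of_dist_le_mul fun x hx y hy => ?_
    rw [Real.dist_eq, Real.dist_eq, Real.coe_toNNReal _ (by positivity)]
    rcases le_total x y with h | h
    · rw [abs_sub_comm, abs_sub_comm x]
      exact key x y hx.1 h hy.2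
    · exact key y x hy.1 h hx.2
  obtain ⟨t, ht, hts⟩ := intermediate_value_Icc ht0 hc
    ⟨by rw [hittingTime_zero]; exact hs.1, hs.2.trans hS⟩
  exact ⟨t, ht.1, by linarith [ht.2], hts⟩

/-! ### The fluid limit -/

open Classical in
/-- The fluid limit `x' = 1 - x ^ d`, `x 0 = 0`, of the fraction of taken schools, as the inverse
of `hittingTime d` (with junk values outside the range of `hittingTime d`). -/
noncomputable def fluid (d : ℕ) (s : ℝ) : ℝ :=
  if h : ∃ t, 0 ≤ t ∧ t < 1 ∧ hittingTime d t = s then h.choose else 0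

lemma fluid_spec {d : ℕ} (hd : 0 < d) {s : ℝ} (hs : s ∈ Set.Icc (0 : ℝ) 1) :
    0 ≤ fluid d s ∧ fluid d s < 1 ∧ hittingTime d (fluid d s) = s := by
  have h := exists_hittingTime_eq hd hs
  rw [fluid, dif_pos h]
  exact h.choose_spec

lemma fluid_zero {d : ℕ} (hd : 0 < d) : fluid d 0 = 0 := by
  obtain ⟨h0, h1, h⟩ := fluid_spec hd (s := 0) ⟨le_rfl, zero_le_one⟩
  by_contra hne
  have := hittingTime_lt hd le_rfl (lt_of_le_of_ne h0 (Ne.symm hne)) h1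
  rw [h, hittingTime_zero] at this
  exact this.false

lemma fluid_pos {d : ℕ} (hd : 0 < d) {s : ℝ} (hs : s ∈ Set.Ioc (0 : ℝ) 1) : 0 < fluid d s := by
  obtain ⟨h0, h1, h⟩ := fluid_spec hd ⟨hs.1.le, hs.2⟩
  refine lt_of_le_of_ne h0 fun hne => ?_
  rw [← hne, hittingTime_zero] at h
  exact hs.1.ne h

/-- The differential equation in finite-difference form, obtained by inverting
`hittingTime_sub_bounds`. -/
lemma fluid_sub_bounds {d : ℕ} (hd : 0 < d) {s s' : ℝ} (h0 : 0 ≤ s) (h : s ≤ s') (h1 : s' ≤ 1) :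
    (s' - s) * (1 - fluid d s' ^ d) ≤ fluid d s' - fluid d s ∧
      fluid d s' - fluid d s ≤ (s' - s) * (1 - fluid d s ^ d) := by
  obtain ⟨a0, a1, a⟩ := fluid_spec hd (s := s) ⟨h0, h.trans h1⟩
  obtain ⟨b0, b1, b⟩ := fluid_spec hd (s := s') ⟨h0.trans h, h1⟩
  have hle : fluid d s ≤ fluid d s' := by
    by_contra! hlt
    have := hittingTime_lt hd b0 hlt a1
    linarith
  have key := hittingTime_sub_bounds hd a0 hle b1
  rw [a, b, div_le_iff₀ (sub_pos.2 (pow_lt_one₀ a0 a1 hd.ne')),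
    le_div_iff₀ (sub_pos.2 (pow_lt_one₀ b0 b1 hd.ne'))] at key
  exact ⟨key.2, key.1⟩

lemma fluid_sub_mem {d : ℕ} (hd : 0 < d) {s s' : ℝ} (h0 : 0 ≤ s) (h : s ≤ s') (h1 : s' ≤ 1) :
    0 ≤ fluid d s' - fluid d s ∧ fluid d s' - fluid d s ≤ s' - s := by
  obtain ⟨a, b⟩ := fluid_sub_bounds hd h0 h h1
  obtain ⟨a0, a1, -⟩ := fluid_spec hd (s := s) ⟨h0, h.trans h1⟩
  obtain ⟨b0, b1, -⟩ := fluid_spec hd (s := s') ⟨h0.trans h, h1⟩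
  have hd' : 0 ≤ s' - s := by linarith
  have hb : 0 ≤ 1 - fluid d s' ^ d := sub_nonneg.2 (pow_le_one₀ b0 b1.le)
  exact ⟨(mul_nonneg hd' hb).trans a,
    b.trans (mul_le_of_le_one_right hd' (by linarith [pow_nonneg a0 d]))⟩

lemma continuousOn_fluid {d : ℕ} (hd : 0 < d) : ContinuousOn (fluid d) (Set.Icc 0 1) := by
  refine LipschitzOnWith.continuousOn (K := 1) ?_
  refine LipschitzOnWith.of_dist_le_mul fun x hx y hy => ?_
  rw [Real.dist_eq, Real.dist_eq, NNReal.coe_one, one_mul]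
  rcases le_total x y with h | h
  · obtain ⟨a, b⟩ := fluid_sub_mem hd hx.1 h hy.2
    rw [abs_sub_comm, abs_sub_comm x, abs_of_nonneg a]
    exact b.trans (le_abs_self _)
  · obtain ⟨a, b⟩ := fluid_sub_mem hd hy.1 h hx.2
    rw [abs_of_nonneg a]
    exact b.trans (le_abs_self _)

/-! ### Comparison of fluid limits for two list lengths -/

lemma hasSum_hittingTime_tail {d : ℕ} (hd : 0 < d) {t : ℝ} (h0 : 0 < t) (h1 : t < 1) :
    HasSum (fun k : ℕ => (t ^ d) ^ (k + 1) / (((k + 1) * d : ℕ) + 1 : ℝ))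
      (hittingTime d t / t - 1) := by
  have h := (summable_hittingTime hd h0.le h1).hasSum.div_const t
  have e : ∀ k : ℕ, t ^ (k * d + 1) / ((k * d : ℕ) + 1 : ℝ) / t =
      (t ^ d) ^ k / ((k * d : ℕ) + 1 : ℝ) := by
    intro k
    rw [← pow_mul, mul_comm d, pow_succ, div_right_comm, mul_div_cancel_right₀ _ h0.ne']
  simp only [e] at h
  have := (hasSum_nat_add_iff' 1).2 h
  simpa [hittingTime] using this

/-- In the fluid limit, longer lists decrease the fraction of students that stay unmatched, up to
time `1`. -/
lemma fluid_pow_lt {d l : ℕ} (hd : 0 < d) (hdl : d < l) {s : ℝ} (hs : s ∈ Set.Ioc (0 : ℝ) 1) :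
    fluid l s ^ l < fluid d s ^ d := by
  have hl : 0 < l := hd.trans hdl
  obtain ⟨-, t1, ht⟩ := fluid_spec hd ⟨hs.1.le, hs.2⟩
  obtain ⟨r0, r1, hr⟩ := fluid_spec hl ⟨hs.1.le, hs.2⟩
  have t0 := fluid_pos hd hs
  set t := fluid d s
  set r := fluid l s
  -- If `r ^ l ≥ t ^ d`, then `r ≥ t ^ θ` with `θ = d/l`, so the longer-list limit reaches level `t
  -- ^ θ` by time `s`. Both tail series are then power series in the same variable `t ^ d`.
  by_contra! hle
  have hl' : (0 : ℝ) < l := by exact_mod_cast hl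
  have hd' : (0 : ℝ) < d := by exact_mod_cast hd
  have hdl' : (d : ℝ) < l := by exact_mod_cast hdl
  set θ : ℝ := d / l with hθ
  have hθ0 : 0 < θ := by positivity
  have hθ1 : θ < 1 := by rw [hθ, div_lt_one hl']; exact hdl'
  have q0 : 0 < t ^ θ := Real.rpow_pos_of_pos t0 _
  have q1 : t ^ θ < 1 := Real.rpow_lt_one t0.le t1 hθ0
  have ql : (t ^ θ) ^ l = t ^ d := by
    rw [← Real.rpow_natCast, ← Real.rpow_mul t0.le, hθ, div_mul_cancel₀ _ hl'.ne',
      Real.rpow_natCast]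
  have hqr : t ^ θ ≤ r := by
    rw [← ql] at hle
    exact le_of_pow_le_pow_left₀ hl.ne' r0 hle
  have hqs : hittingTime l (t ^ θ) ≤ s := by
    rcases hqr.eq_or_lt with h | h
    · rw [h, hr]
    · rw [← hr]; exact (hittingTime_lt hl q0.le h r1).le
  have hbern : (t ^ θ)⁻¹ ≤ 1 + θ * (t⁻¹ - 1) := by
    rw [← Real.inv_rpow t0.le]
    have ht1 : 1 ≤ t⁻¹ := (one_le_inv₀ t0).2 t1.le
    have := rpow_one_add_le_one_add_mul_self (s := t⁻¹ - 1) (by linarith) hθ0.le hθ1.le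
    simpa using this
  have sd := hasSum_hittingTime_tail hd t0 t1
  have sl := hasSum_hittingTime_tail hl q0 q1
  rw [ht] at sd
  rw [ql] at sl
  -- Termwise, with `m = k + 1`: `θ * (m * l + 1) = m * d + θ < m * d + 1`.
  have hlt : θ * (s / t - 1) < hittingTime l (t ^ θ) / t ^ θ - 1 := by
    have hterm : ∀ k : ℕ, θ * ((t ^ d) ^ (k + 1) / (((k + 1) * d : ℕ) + 1 : ℝ)) <
        (t ^ d) ^ (k + 1) / (((k + 1) * l : ℕ) + 1 : ℝ) := by
      intro k
      have hp : 0 < (t ^ d) ^ (k + 1) := by positivity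
      have : θ / (((k + 1) * d : ℕ) + 1 : ℝ) < 1 / (((k + 1) * l : ℕ) + 1 : ℝ) := by
        rw [hθ, div_div, div_lt_div_iff₀ (by positivity) (by positivity)]
        push_cast
        nlinarith
      calc _ = (t ^ d) ^ (k + 1) * (θ / (((k + 1) * d : ℕ) + 1 : ℝ)) := by ring
        _ < (t ^ d) ^ (k + 1) * (1 / (((k + 1) * l : ℕ) + 1 : ℝ)) := by gcongr
        _ = _ := by ring
    exact hasSum_lt (fun k => (hterm k).le) (hterm 0) (sd.mul_left θ) sl
  have h1 : s * (t ^ θ)⁻¹ ≤ s * (1 + θ * (t⁻¹ - 1)) := mul_le_mul_of_nonneg_left hbern hs.1.le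
  have h2 : hittingTime l (t ^ θ) / t ^ θ ≤ s * (t ^ θ)⁻¹ := by
    rw [← div_eq_mul_inv]; gcongr
  have h3 : s / t = s * t⁻¹ := div_eq_mul_inv _ _
  rw [h3] at hlt
  -- The inequalities combine to `(1 - θ) * (1 - s) < 0`, which `s ≤ 1` excludes.
  nlinarith [mul_nonneg (sub_nonneg.2 hs.2) (sub_nonneg.2 hθ1.le)]

lemma exists_fluid_gap {d l : ℕ} (hd : 0 < d) (hdl : d < l) {ε : ℝ} (hε : 0 < ε) :
    ∃ δ > 0, ∀ s ∈ Set.Icc ε 1, fluid l s ^ l + δ ≤ fluid d s ^ d := by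
  rcases (Set.Icc ε 1).eq_empty_or_nonempty with he | hne
  · exact ⟨1, one_pos, by simp [he]⟩
  have hsub : Set.Icc ε 1 ⊆ Set.Icc 0 1 := Set.Icc_subset_Icc_left hε.le
  have hc : ContinuousOn (fun s => fluid d s ^ d - fluid l s ^ l) (Set.Icc ε 1) :=
    (((continuousOn_fluid hd).pow d).sub ((continuousOn_fluid (hd.trans hdl)).pow l)).mono hsub
  obtain ⟨s, hs, hmin⟩ := isCompact_Icc.exists_isMinOn hne hc
  refine ⟨_, sub_pos.2 (fluid_pow_lt hd hdl ⟨hε.trans_le hs.1, hs.2⟩), fun s' hs' => ?_⟩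
  have : fluid d s ^ d - fluid l s ^ l ≤ fluid d s' ^ d - fluid l s' ^ l := hmin hs'
  linarith

/-! ### From the random market to the chain -/

lemma choice_eq_none_iff {n d : ℕ} {S : Finset (Fin n)} {a : PrefList n d} :
    choice S a = none ↔ ∀ k, a k ∈ S := by
  simp [choice]

lemma card_taken_succ {n d : ℕ} (L : ℕ → PrefList n d) (i : ℕ) [Decidable (∀ k, L i k ∈ taken L i)] :
    (taken L (i + 1)).card =
      if ∀ k, L i k ∈ taken L i then (taken L i).card else (taken L i).card + 1 := by
  rw [taken]
  split
  next h => rw [if_pos (choice_eq_none_iff.1 h)]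
  next k h =>
    have hk : L i k ∉ taken L i := by
      have := (Fin.find?_eq_some_iff.1 h).1
      simpa using this
    rw [if_neg fun hall => hk (hall k), Finset.card_insert_of_notMem hk]

lemma matched_eq_one_iff {n d : ℕ} (L : ℕ → PrefList n d) (i : ℕ) :
    matched L i = 1 ↔ ¬ ∀ k, L i k ∈ taken L i := by
  rw [← choice_eq_none_iff, matched, rank]
  cases choice (taken L i) (L i) with
  | none => simp
  | some k => simp

lemma taken_congr {n d : ℕ} {L L' : ℕ → PrefList n d} {i : ℕ} (h : ∀ j < i, L j = L' j) :
    taken L i = taken L' i := by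
  induction i with
  | zero => rfl
  | succ i ih => rw [taken, taken, ih fun j hj => h j (by omega), h i (by omega)]

lemma card_setOf_forall_mem {n d : ℕ} (S : Finset (Fin n)) :
    Nat.card {a : PrefList n d | ∀ k, a k ∈ S} = S.card.descFactorial d := by
  classical
  let e : {a : PrefList n d | ∀ k, a k ∈ S} ≃ (Fin d ↪ S) :=
    { toFun := fun a => ⟨fun k => ⟨a.1 k, a.2 k⟩, fun x y h => a.1.injective (by simpa using h)⟩
      invFun := fun b => ⟨b.trans (Function.Embedding.subtype _), fun k => (b k).2⟩
      left_inv := fun a => rfl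
      right_inv := fun b => rfl }
  rw [Nat.card_congr e, Nat.card_eq_fintype_card, Fintype.card_embedding_eq]
  simp

lemma uniformOn_real_forall_mem {n d : ℕ} (S : Finset (Fin n)) :
    (uniformOn (Set.univ : Set (PrefList n d))).real {a | ∀ k, a k ∈ S} =
      blocked n d S.card := by
  have hc : Measure.count {a : PrefList n d | ∀ k, a k ∈ S} =
      ((S.card.descFactorial d : ℕ) : ENNReal) := by
    rw [Measure.count_apply (by trivial), Set.encard, ENat.card_eq_coe_natCard,
      card_setOf_forall_mem]
    rfl
  rw [Measure.real, uniformOn_univ, hc, ENNReal.toReal_div, Fintype.card_embedding_eq,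
    ENNReal.toReal_natCast, ENNReal.toReal_natCast]
  simp only [Fintype.card_fin, blocked, Nat.descFactorial_eq_factorial_mul_choose,
    Nat.cast_mul]
  exact mul_div_mul_left _ _ (by positivity)

section

variable {Ω : Type*} [MeasurableSpace Ω] {P : Measure Ω} [IsProbabilityMeasure P] {n d : ℕ}
  {L : ℕ → Ω → PrefList n d}

attribute [local instance] Classical.propDecidable

/-- The list of the next student is independent of the set of schools that are taken. -/
lemma IsRandomMarket.integral_taken_list (h : IsRandomMarket P L) (i : ℕ)
    (f : Finset (Fin n) → PrefList n d → ℝ) :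
    ∫ ω, f (taken (fun j => L j ω) i) (L i ω) ∂P =
      ∫ ω, ∫ a, f (taken (fun j => L j ω) i) a ∂(uniformOn Set.univ) ∂P := by
  let _ : MeasurableSpace (Finset (Fin n)) := ⊤
  obtain ⟨ω₀⟩ : Nonempty Ω := P.nonempty_of_neZero
  let T : Ω → Finset (Fin n) := fun ω => taken (fun j => L j ω) i
  -- Writes the taken set as a function of the first `i` lists; the padding by `L j ω₀` is never
  -- read.
  let φ : (Finset.range i → PrefList n d) → Finset (Fin n) := fun v =>
    taken (fun j => if hj : j ∈ Finset.range i then v ⟨j, hj⟩ else L j ω₀) i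
  have hT : T = φ ∘ fun ω (j : Finset.range i) => L j ω := by
    funext ω
    refine taken_congr fun j hj => ?_
    simp [hj]
  have hφ : Measurable φ := .of_discrete
  have hTm : Measurable T := by
    rw [hT]
    exact hφ.comp (measurable_pi_lambda _ fun j => h.measurable j)
  have hind : IndepFun T (L i) P := by
    have h1 := h.indep.indepFun_finset (Finset.range i) {i} (by simp) h.measurable
    rw [hT]
    exact h1.comp hφ (measurable_pi_apply (⟨i, by simp⟩ : ({i} : Finset ℕ)))
  have hmap := (indepFun_iff_map_prod_eq_prod_map_map hTm.aemeasurable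
    (h.measurable i).aemeasurable).1 hind
  rw [h.uniform i] at hmap
  have hU : IsProbabilityMeasure (uniformOn (Set.univ : Set (PrefList n d))) := by
    rw [← h.uniform i]
    exact Measure.isProbabilityMeasure_map (h.measurable i).aemeasurable
  have hTP : IsProbabilityMeasure (P.map T) := Measure.isProbabilityMeasure_map hTm.aemeasurable
  have hF : Measurable (fun p : Finset (Fin n) × PrefList n d => f p.1 p.2) := .of_discrete
  have hG : Measurable (fun S => ∫ a, f S a ∂(uniformOn Set.univ)) := .of_discrete
  calc ∫ ω, f (T ω) (L i ω) ∂P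
      = ∫ p, f p.1 p.2 ∂(P.map fun ω => (T ω, L i ω)) :=
        (integral_map (hTm.prodMk (h.measurable i)).aemeasurable
          hF.aestronglyMeasurable).symm
    _ = ∫ S, ∫ a, f S a ∂(uniformOn Set.univ) ∂(P.map T) := by
        rw [hmap, integral_prod _ .of_finite]
    _ = _ := integral_map hTm.aemeasurable hG.aestronglyMeasurable

lemma IsRandomMarket.integral_ite (h : IsRandomMarket P L) (S : Finset (Fin n)) (x y : ℝ) :
    ∫ a : PrefList n d, (if ∀ k, a k ∈ S then x else y) ∂(uniformOn Set.univ) =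
      blocked n d S.card * x + (1 - blocked n d S.card) * y := by
  have hU : IsProbabilityMeasure (uniformOn (Set.univ : Set (PrefList n d))) := by
    rw [← h.uniform 0]
    exact Measure.isProbabilityMeasure_map (h.measurable 0).aemeasurable
  have e : (fun a : PrefList n d => if ∀ k, a k ∈ S then x else y) =
      fun a => Set.indicator {a : PrefList n d | ∀ k, a k ∈ S} (fun _ => x - y) a + y := by
    funext a
    by_cases ha : ∀ k, a k ∈ S <;> simp [Set.indicator, ha]
  rw [e, integral_add .of_finite .of_finite, integral_indicator_const _ (by trivial),
    uniformOn_real_forall_mem]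
  simp
  ring

lemma IsRandomMarket.integral_card_taken (h : IsRandomMarket P L) (i : ℕ) (G : ℕ → ℝ) :
    ∫ ω, G (taken (fun j => L j ω) i).card ∂P = expect n d i G := by
  induction i generalizing G with
  | zero => simp [taken, expect]
  | succ i ih =>
    have e : ∀ ω, G (taken (fun j => L j ω) (i + 1)).card =
        if ∀ k, L i ω k ∈ taken (fun j => L j ω) i then G (taken (fun j => L j ω) i).card
        else G ((taken (fun j => L j ω) i).card + 1) := by
      intro ω
      rw [card_taken_succ, apply_ite G]
    simp only [e]
    rw [h.integral_taken_list i fun S a => if ∀ k, a k ∈ S then G S.card else G (S.card + 1)]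
    simp only [h.integral_ite]
    exact ih (step n d G)

/-- The probability that a student is matched, through the number of taken schools. -/
lemma IsRandomMarket.measure_matched (h : IsRandomMarket P L) (i : ℕ) :
    P {ω | matched (fun j => L j ω) i = 1} = ENNReal.ofReal (1 - expect n d i (blocked n d)) := by
  have e : {ω | matched (fun j => L j ω) i = 1} =
      {ω | ¬ ∀ k, L i ω k ∈ taken (fun j => L j ω) i} := by
    ext ω
    exact matched_eq_one_iff _ _
  have hm : MeasurableSet {ω | ¬ ∀ k, L i ω k ∈ taken (fun j => L j ω) i} := by
    let φ : (Finset.range (i + 1) → PrefList n d) → Prop := fun v =>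
      ¬ ∀ k, v ⟨i, by simp⟩ k ∈
        taken (fun j => if hj : j ∈ Finset.range (i + 1) then v ⟨j, hj⟩ else v ⟨i, by simp⟩) i
    have hφ : MeasurableSet {v | φ v} := .of_discrete
    have hv : Measurable fun ω (j : Finset.range (i + 1)) => L j ω :=
      measurable_pi_lambda _ fun j => h.measurable j
    have hset : {ω | ¬ ∀ k, L i ω k ∈ taken (fun j => L j ω) i} =
        (fun ω (j : Finset.range (i + 1)) => L j ω) ⁻¹' {v | φ v} := by
      ext ω
      have ht : taken (fun j => L j ω) i =
          taken (fun j => if j ∈ Finset.range (i + 1) then L j ω else L i ω) i :=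
        taken_congr fun j hj => by simp [show j < i + 1 by omega]
      change (¬ ∀ k, L i ω k ∈ taken (fun j => L j ω) i) ↔
        ¬ ∀ k, L i ω k ∈ taken (fun j => if j ∈ Finset.range (i + 1) then L j ω else L i ω) i
      rw [ht]
    rw [hset]
    exact hv hφ
  have h1 : P.real {ω | ¬ ∀ k, L i ω k ∈ taken (fun j => L j ω) i} =
      1 - expect n d i (blocked n d) := by
    have h2 := h.integral_taken_list i fun S a => if ∀ k, a k ∈ S then (0 : ℝ) else 1
    simp only [h.integral_ite] at h2
    have h3 := h.integral_card_taken i fun s => blocked n d s * 0 + (1 - blocked n d s) * 1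
    rw [h3] at h2
    have h4 : expect n d i (fun s => blocked n d s * 0 + (1 - blocked n d s) * 1) =
        1 - expect n d i (blocked n d) := by
      have := expect_add n d i (fun s => blocked n d s)
        (fun s => blocked n d s * 0 + (1 - blocked n d s) * 1)
      have e1 : (fun s => blocked n d s + (blocked n d s * 0 + (1 - blocked n d s) * 1)) =
        fun _ => (1 : ℝ) := by funext s; ring
      rw [e1, expect_const] at this
      linarith
    rw [← h4, ← h2, ← integral_indicator_one hm]
    congr 1
    funext ω
    by_cases hω : ∀ k, L i ω k ∈ taken (fun j => L j ω) i <;> simp [Set.indicator, hω]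
  rw [e, ← h1, ofReal_measureReal]

end

/-! ### Mean-square convergence to the fluid limit -/

lemma abs_pow_sub_pow_le {x y : ℝ} (hx0 : 0 ≤ x) (hx1 : x ≤ 1) (hy0 : 0 ≤ y) (hy1 : y ≤ 1)
    (d : ℕ) : |x ^ d - y ^ d| ≤ d * |x - y| := by
  induction d with
  | zero => simp
  | succ k ih =>
    have e : x ^ (k + 1) - y ^ (k + 1) = x * (x ^ k - y ^ k) + y ^ k * (x - y) := by ring
    rw [e]
    refine (abs_add_le _ _).trans ?_
    rw [abs_mul, abs_mul, abs_of_nonneg hx0, abs_of_nonneg (pow_nonneg hy0 k)]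
    have h1 : x * |x ^ k - y ^ k| ≤ |x ^ k - y ^ k| := mul_le_of_le_one_left (abs_nonneg _) hx1
    have h2 : y ^ k * |x - y| ≤ |x - y| :=
      mul_le_of_le_one_left (abs_nonneg _) (pow_le_one₀ hy0 hy1)
    push_cast
    linarith

/-- One step increases the mean square distance to the fluid limit only by `O(n⁻²)`, since the
drift is decreasing. -/
lemma step_sq_le {n d i s : ℕ} (hd : 0 < d) (hdn : d ≤ n) (hi : i < n) (hs : s ≤ i) :
    step n d (fun s => ((s : ℝ) / n - fluid d ((i + 1 : ℕ) / n)) ^ 2) s ≤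
      ((s : ℝ) / n - fluid d (i / n)) ^ 2 + (2 + 2 * d + 2 * d ^ 2) / n ^ 2 := by
  have hn : (0 : ℝ) < n := by exact_mod_cast hd.trans_le hdn
  have hsn : s ≤ n := by omega
  have hi0 : (0 : ℝ) ≤ i / n := by positivity
  have hi' : ((i + 1 : ℕ) : ℝ) / n = i / n + 1 / n := by push_cast; ring
  have hn0 : (0 : ℝ) < 1 / n := by positivity
  have hi1 : ((i + 1 : ℕ) : ℝ) / n ≤ 1 := by
    rw [div_le_one hn]
    exact_mod_cast hi
  have hle : (i : ℝ) / n ≤ ((i + 1 : ℕ) : ℝ) / n := by rw [hi']; linarith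
  obtain ⟨y0, y1, -⟩ := fluid_spec hd (s := (i : ℝ) / n) ⟨hi0, hle.trans hi1⟩
  obtain ⟨z0, z1, -⟩ := fluid_spec hd (s := ((i + 1 : ℕ) : ℝ) / n) ⟨hi0.trans hle, hi1⟩
  obtain ⟨b1, b2⟩ := fluid_sub_bounds hd hi0 hle hi1
  obtain ⟨c1, c2⟩ := fluid_sub_mem hd hi0 hle hi1
  have hw : ((i + 1 : ℕ) : ℝ) / n - i / n = 1 / n := by rw [hi']; ring
  rw [hw] at b1 b2 c2
  have hbl := abs_blocked_sub_le hdn hsn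
  have q0 := blocked_nonneg n d s
  have q1 : blocked n d s ≤ 1 := blocked_le_one hsn
  have X0 : 0 ≤ (s : ℝ) / n := by positivity
  have X1 : (s : ℝ) / n ≤ 1 := div_le_one_of_le₀ (by exact_mod_cast hsn) hn.le
  have hpz := abs_pow_sub_pow_le z0 z1.le y0 y1.le d
  rw [abs_of_nonneg c1] at hpz
  set y := fluid d (i / n)
  set z := fluid d ((i + 1 : ℕ) / n)
  set q := blocked n d s
  set X := (s : ℝ) / n
  have hX' : ((s + 1 : ℕ) : ℝ) / n = X + 1 / n := by push_cast; simp only [X]; ring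
  set h : ℝ := 1 / n with hh
  have hd2 : (d : ℝ) ^ 2 / n = d ^ 2 * h := by rw [hh]; ring
  have hdz : z ^ d - y ^ d ≤ d * h :=
    (le_abs_self _).trans (hpz.trans (by gcongr))
  rw [hd2] at hbl
  have hrhs : (2 + 2 * (d : ℝ) + 2 * d ^ 2) / n ^ 2 = (2 + 2 * d + 2 * d ^ 2) * h ^ 2 := by
    rw [hh]; ring
  rw [hrhs]
  simp only [step, hX']
  have hexp : q * (X - z) ^ 2 + (1 - q) * (X + h - z) ^ 2 = (X - y) ^ 2 +
      2 * ((X - y) * ((1 - q) * h - (z - y))) +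
      ((z - y) ^ 2 - 2 * ((1 - q) * (z - y) * h) + (1 - q) * h ^ 2) := by ring
  have hq : 0 ≤ 1 - q := by linarith
  have hbr : (z - y) ^ 2 - 2 * ((1 - q) * (z - y) * h) + (1 - q) * h ^ 2 ≤ 2 * h ^ 2 := by
    have a1 : (z - y) ^ 2 ≤ h ^ 2 := by gcongr
    have a2 : 0 ≤ (1 - q) * (z - y) * h := by positivity
    have a3 : (1 - q) * h ^ 2 ≤ h ^ 2 := mul_le_of_le_one_left (by positivity) (by linarith)
    linarith
  have hXy : |X - y| ≤ 1 := by rw [abs_le]; constructor <;> linarith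
  -- The drift `1 - x ^ d` decreases in `x`, so it pulls the chain towards the fluid limit; no
  -- Grönwall factor arises.
  have hmono : (X - y) * (y ^ d - X ^ d) ≤ 0 := by
    rcases le_total X y with hxy | hxy
    · exact mul_nonpos_of_nonpos_of_nonneg (by linarith)
        (sub_nonneg.2 (pow_le_pow_left₀ X0 hxy d))
    · exact mul_nonpos_of_nonneg_of_nonpos (by linarith)
        (sub_nonpos.2 (pow_le_pow_left₀ y0 hxy d))
  -- Two errors: replacing `blocked` by the power costs `d ^ 2 * h ^ 2`, and the Euler step of the
  -- differential equation costs `d * h ^ 2`.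
  have herr : |(X ^ d - q) * h + ((1 - y ^ d) * h - (z - y))| ≤ (d + d ^ 2) * h ^ 2 := by
    refine (abs_add_le _ _).trans ?_
    rw [abs_mul, abs_of_pos hn0, abs_sub_comm (X ^ d) q,
      abs_of_nonneg (by linarith : 0 ≤ (1 - y ^ d) * h - (z - y))]
    have a1 := mul_le_mul_of_nonneg_right hbl hn0.le
    have a2 := mul_le_mul_of_nonneg_right hdz hn0.le
    nlinarith
  have hmain : (X - y) * ((1 - q) * h - (z - y)) ≤ (d + d ^ 2) * h ^ 2 := by
    have e : (X - y) * ((1 - q) * h - (z - y)) = h * ((X - y) * (y ^ d - X ^ d)) +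
        (X - y) * ((X ^ d - q) * h + ((1 - y ^ d) * h - (z - y))) := by ring
    have a1 := mul_nonpos_of_nonneg_of_nonpos hn0.le hmono
    have a2 : (X - y) * ((X ^ d - q) * h + ((1 - y ^ d) * h - (z - y))) ≤
        1 * ((d + d ^ 2) * h ^ 2) := by
      refine (le_abs_self _).trans ?_
      rw [abs_mul]
      exact mul_le_mul hXy herr (abs_nonneg _) zero_le_one
    linarith
  rw [hexp]
  linarith

lemma expect_sq_le {n d i : ℕ} (hd : 0 < d) (hdn : d ≤ n) (hi : i ≤ n) :
    expect n d i (fun s => ((s : ℝ) / n - fluid d (i / n)) ^ 2) ≤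
      i * ((2 + 2 * d + 2 * d ^ 2) / n ^ 2) := by
  induction i with
  | zero => simp [expect, fluid_zero hd]
  | succ i ih =>
    have h := expect_mono (d := d) (by omega : i ≤ n) fun s hs => step_sq_le hd hdn hi hs
    rw [expect_add, expect_const] at h
    have h2 := ih (by omega)
    rw [expect]
    refine h.trans ?_
    push_cast
    linarith

/-- The probability of staying unmatched converges to the `d`-th power of the fluid limit. -/
lemma exists_abs_expect_blocked_sub_le {d : ℕ} (hd : 0 < d) {δ : ℝ} (hδ : 0 < δ) :
    ∃ N : ℕ, ∀ n ≥ N, ∀ i ≤ n,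
      |expect n d i (blocked n d) - fluid d (i / n) ^ d| ≤ δ := by
  have hd' : (0 : ℝ) < d := by exact_mod_cast hd
  set K : ℝ := 2 + 2 * d + 2 * d ^ 2 with hK
  have hK0 : 0 < K := by positivity
  set γ : ℝ := δ / (2 * d) with hγ
  have hγ0 : 0 < γ := by positivity
  -- The final bound is `d * γ` plus terms of order `1/n`. The choice of `γ` makes the former `δ/2`,
  -- and `N` makes the latter at most `δ/2`.
  obtain ⟨N, hN⟩ := exists_nat_gt ((d ^ 2 + d * K / γ) / (δ / 2))
  refine ⟨max N d, fun n hn i hi => ?_⟩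
  have hdn : d ≤ n := (le_max_right _ _).trans hn
  have hNn : (N : ℝ) ≤ n := by exact_mod_cast (le_max_left _ _).trans hn
  have hn0 : (0 : ℝ) < n := by exact_mod_cast hd.trans_le hdn
  have hsmall : (d ^ 2 + d * K / γ) / n ≤ δ / 2 := by
    rw [div_le_iff₀ hn0, mul_comm (δ / 2), ← div_le_iff₀ (by positivity)]
    exact hN.le.trans hNn
  have hi1 : (i : ℝ) / n ≤ 1 := div_le_one_of_le₀ (by exact_mod_cast hi) hn0.le
  obtain ⟨y0, y1, -⟩ := fluid_spec hd (s := (i : ℝ) / n) ⟨by positivity, hi1⟩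
  have hsq : expect n d i (fun s => ((s : ℝ) / n - fluid d (i / n)) ^ 2) ≤ K / n := by
    refine (expect_sq_le hd hdn hi).trans ?_
    calc (i : ℝ) * (K / n ^ 2) = i / n * (K / n) := by ring
      _ ≤ 1 * (K / n) := by gcongr
      _ = _ := one_mul _
  set y := fluid d (i / n)
  have hpt : ∀ s ≤ i, |blocked n d s - y ^ d| ≤
      (d ^ 2 / n + d * γ) + d / γ * ((s : ℝ) / n - y) ^ 2 := by
    intro s hs
    have hsn : s ≤ n := hs.trans hi
    have X1 : (s : ℝ) / n ≤ 1 := div_le_one_of_le₀ (by exact_mod_cast hsn) hn0.le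
    have h1 := abs_blocked_sub_le hdn hsn
    have h2 := abs_pow_sub_pow_le (by positivity) X1 y0 y1.le d
    -- Trades the absolute deviation for its square, whose expectation is controlled.
    have h3 : |(s : ℝ) / n - y| ≤ γ + ((s : ℝ) / n - y) ^ 2 / γ := by
      rw [← sq_abs]
      set a := |(s : ℝ) / n - y|
      have ha : 0 ≤ a := abs_nonneg _
      have : a * γ ≤ (γ + a ^ 2 / γ) * γ := by
        rw [add_mul, div_mul_cancel₀ _ hγ0.ne']
        nlinarith [sq_nonneg (a - γ)]
      exact le_of_mul_le_mul_right this hγ0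
    have h4 := abs_sub_le (blocked n d s) (((s : ℝ) / n) ^ d) (y ^ d)
    have h5 := mul_le_mul_of_nonneg_left h3 hd'.le
    have h6 : (d : ℝ) / γ * ((s : ℝ) / n - y) ^ 2 = d * (((s : ℝ) / n - y) ^ 2 / γ) := by ring
    rw [h6]
    linarith
  have hbound : expect n d i (fun s => (d ^ 2 / n + d * γ) + d / γ * ((s : ℝ) / n - y) ^ 2) ≤
      δ := by
    rw [expect_add, expect_const, expect_const_mul]
    have h1 : (d : ℝ) / γ * expect n d i (fun s => ((s : ℝ) / n - y) ^ 2) ≤ d / γ * (K / n) := by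
      gcongr
    have h2 : (d : ℝ) * γ = δ / 2 := by rw [hγ]; field_simp
    have h3 : (d ^ 2 + d * K / γ) / n = d ^ 2 / n + d / γ * (K / n) := by ring
    linarith
  have hup := expect_mono (n := n) (d := d) hi fun s hs =>
    (by have := (abs_le.1 (hpt s hs)).2; linarith : blocked n d s ≤
      y ^ d + ((d ^ 2 / n + d * γ) + d / γ * ((s : ℝ) / n - y) ^ 2))
  have hlo := expect_mono (n := n) (d := d) hi fun s hs =>
    (by have := (abs_le.1 (hpt s hs)).1; linarith : y ^ d ≤
      blocked n d s + ((d ^ 2 / n + d * γ) + d / γ * ((s : ℝ) / n - y) ^ 2))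
  rw [expect_add n d i (fun _ => y ^ d), expect_const] at hup
  rw [expect_add n d i (fun s => blocked n d s), expect_const] at hlo
  rw [abs_le]
  constructor <;> linarith

/-! ### Combining the two time ranges -/

lemma exists_expect_blocked_le {d l : ℕ} (hd : 0 < d) (hdl : d < l) :
    ∃ N : ℕ, ∀ n ≥ N, ∀ i ≤ n, expect n l i (blocked n l) ≤ expect n d i (blocked n d) := by
  obtain ⟨δ, hδ, hgap⟩ := exists_fluid_gap hd hdl (ε := 1 / ((d : ℝ) + 1)) (by positivity)
  obtain ⟨N₁, h₁⟩ := exists_abs_expect_blocked_sub_le hd (half_pos hδ)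
  obtain ⟨N₂, h₂⟩ := exists_abs_expect_blocked_sub_le (hd.trans hdl) (half_pos hδ)
  refine ⟨max l (max N₁ N₂), fun n hn i hi => ?_⟩
  simp only [ge_iff_le, max_le_iff] at hn
  rcases le_total ((i : ℝ) / n) (1 / (d + 1)) with h | h
  · exact expect_blocked_le_of_early hd hdl hn.1 hi h
  · have a := (abs_le.1 (h₁ n hn.2.1 i hi)).1
    have b := (abs_le.1 (h₂ n hn.2.2 i hi)).2
    have c := hgap (i / n) ⟨h, div_le_one_of_le₀ (by exact_mod_cast hi) (by positivity)⟩
    linarith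

end SerialDictatorship

/-- Students are indexed from `0`: index `i` is position `i + 1`, so the positions `1, …, n` are
the indices `i < n`. The two markets may live on different probability spaces. -/
theorem theorem1 (d l : ℕ) (hdl : d ≤ l) :
    ∃ N : ℕ, ∀ n : ℕ, N ≤ n →
      ∀ (Ω : Type*) [MeasurableSpace Ω] (P : Measure Ω) [IsProbabilityMeasure P]
        (Ω' : Type*) [MeasurableSpace Ω'] (P' : Measure Ω') [IsProbabilityMeasure P']
        (L : ℕ → Ω → PrefList n d) (L' : ℕ → Ω' → PrefList n l),
        SerialDictatorship.IsRandomMarket P L → SerialDictatorship.IsRandomMarket P' L' →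
        ∀ i < n,
          P {ω | SerialDictatorship.matched (fun j => L j ω) i = 1} ≤
            P' {ω | SerialDictatorship.matched (fun j => L' j ω) i = 1} := by
  have key : ∃ N : ℕ, ∀ n ≥ N, ∀ i ≤ n,
      SerialDictatorship.expect n l i (SerialDictatorship.blocked n l) ≤
        SerialDictatorship.expect n d i (SerialDictatorship.blocked n d) := by
    rcases hdl.eq_or_lt with rfl | hlt
    · exact ⟨0, fun n _ i _ => le_rfl⟩
    -- The fluid argument needs `d > 0`; with empty lists everyone stays unmatched.
    rcases Nat.eq_zero_or_pos d with rfl | hd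
    · refine ⟨0, fun n _ i hi => ?_⟩
      calc _ ≤ SerialDictatorship.expect n l i fun _ => 1 :=
            SerialDictatorship.expect_mono hi fun s hs =>
              SerialDictatorship.blocked_le_one (hs.trans hi)
        _ = SerialDictatorship.expect n 0 i (SerialDictatorship.blocked n 0) := by
            rw [funext (SerialDictatorship.blocked_zero n), SerialDictatorship.expect_const,
              SerialDictatorship.expect_const]
    · exact SerialDictatorship.exists_expect_blocked_le hd hlt
  obtain ⟨N, hN⟩ := key
  refine ⟨N, fun n hn Ω _ P _ Ω' _ P' _ L L' hL hL' i hi => ?_⟩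
  rw [hL.measure_matched, hL'.measure_matched]
  exact ENNReal.ofReal_le_ofReal (by linarith [hN n hn i hi.le])
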